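/- A convex polytope in $\mathbb{R}^3$ is the convex hull of a nonempty finite set of points (it may have dimension less than three). A Kagan function is a function $f:\mathbb{R}\to\mathbb{R}$ such that $f(a+b)=f(a)+f(b)$ for all $a,b\in\mathbb{R}$ and $f(\pi)=0$. For a convex polytope $P\subset\mathbb{R}^3$ and a Kagan function $f$ put $$D_f(P)\;:=\;\sum_{e\in E(P)}\ell(e)\,f(\alpha_e),$$ where $E(P)$ is the set of edges (one-dimensional faces) of $P$, $\ell(e)$ is the length of the edge $e$, and $\alpha_e$ is the dihedral angle of $P$ at $e$ in radians (with $\alpha_e=0$ if $\dim P<3$). Let $P_1,\ldots,P_k$ be convex polytopes in $\mathbb{R}^3$ and let $t_1,\ldots,t_k\ge 0$ be real numbers. Then $$D_f\bigl(t_1P_1+\ldots+t_kP_k\bigr)\;=\;t_1\,D_f(P_1)+\ldots+t_k\,D_f(P_k)$$ for every Kagan function $f$. Here $P+Q=\{x+y : x\in P,\ y\in Q\}$ is the Minkowski sum and $cP=\{cx : x\in P\}$. -/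

import Mathlib

open scoped Pointwise

/-- Euclidean three-space. -/
abbrev E3 : Type := EuclideanSpace ℝ (Fin 3)

/-- A convex polytope in `ℝ³`: the convex hull of a nonempty finite set of points.
It need not be three-dimensional. -/
def IsConvexPolytope (P : Set E3) : Prop :=
  ∃ s : Set E3, s.Finite ∧ s.Nonempty ∧ P = convexHull ℝ s

/-- The edges of `P`: its one-dimensional faces. A face is the set of points of `P` at which some
linear functional attains its maximum on `P`; it is one-dimensional when it is a segment
with two distinct endpoints. -/
def polytopeEdges (P : Set E3) : Set (Set E3) :=
  {e | IsExposed ℝ P e ∧ ∃ a b : E3, a ≠ b ∧ e = segment ℝ a b}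

/-- A convex polytope has finitely many edges. -/
theorem polytopeEdges_finite {P : Set E3} (hP : IsConvexPolytope P) :
    (polytopeEdges P).Finite := by
  obtain ⟨s, hs, -, rfl⟩ := hP
  refine (hs.finite_subsets.image fun t : Set E3 => closure (convexHull ℝ t)).subset ?_
  rintro e ⟨he, a, b, -, hab⟩
  have hc : IsCompact e := IsExposed.isCompact (𝕜 := ℝ) he (hs.isCompact_convexHull ℝ)
  have hconv : Convex ℝ e := hab ▸ convex_segment a b
  refine ⟨e.extremePoints ℝ, ?_, closure_convexHull_extremePoints hc hconv⟩
  exact he.isExtreme.extremePoints_subset_extremePoints.trans extremePoints_convexHull_subset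

/-- The dihedral angle (in radians) of `P` at the edge `e`: the angle at `p ∈ e` of the section of
`P` by the plane through `p` perpendicular to `e`. As the section is convex, its angle at `p` is the
largest angle `∠ x p y` with `x` and `y` in the section; for every `p` in the relative
interior of `e` this is the dihedral angle, and at the endpoints of `e` it is not larger.
If `P` has dimension less than three, there are no two different directions
from `p` in the section, and the dihedral angle is `0`. -/
noncomputable def dihedralAngle (P e : Set E3) : ℝ :=
  sSup {θ : ℝ | ∃ p ∈ e, ∃ x ∈ P, ∃ y ∈ P, x ≠ p ∧ y ≠ p ∧
    (∀ q ∈ e, inner ℝ (x - p) (q - p) = 0) ∧ (∀ q ∈ e, inner ℝ (y - p) (q - p) = 0) ∧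
    θ = EuclideanGeometry.angle x p y}

/-- A Kagan function: an additive function on the reals that vanishes at `π`. -/
def IsKagan (f : ℝ → ℝ) : Prop :=
  (∀ a b : ℝ, f (a + b) = f a + f b) ∧ f Real.pi = 0

/-- `D_f(P) = ∑ ℓ(e) f(α_e)`, the sum over the edges `e` of `P`, where `ℓ(e)` is the length of `e`
(the diameter of the segment) and `α_e` is the dihedral angle of `P` at `e`. -/
noncomputable def dehnInvariant (f : ℝ → ℝ) (P : Set E3) : ℝ :=
  ∑ᶠ e ∈ polytopeEdges P, Metric.diam e * f (dihedralAngle P e)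

/-! Let `e ≠ P` be an edge with direction `u`. In the plane orthogonal to `u`, the outer normals of
the two faces of `P` meeting at `e` (opposite normals of `P` itself if `P` is flat) have angles
`θ₁`, `θ₂` with `θ₁ - θ₂ = α_e - π` (`exists_flag_angles`). A Kagan function kills `2π`, so it
descends to a homomorphism `g` on `Real.Angle`; as it also kills `π`, `ℓ(e) f(α_e) = ℓ(e) g(θ₁) -
ℓ(e) g(θ₂)`.

Now collect the terms by pairs (line of `u`, normal angle `θ`) instead of by edges. The coefficient
of `g(θ)` is the length of the edge bounding the face with normal `θ` on one side, minus the length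
on the opposite side (`widthJump`). This number is defined for every pair: when the face is only an
edge or a vertex, the two lengths cancel (`widthJump_eq_indicator`). Hence `D_f(P)` is the sum of
`g(θ)` times the jump over all pairs (`dehnInvariant_eq_finsum`).

Taking faces and taking widths both commute with Minkowski sums and nonnegative dilations, so the
jump is linear in `P` (`widthJump_sum`), and so is `D_f`. The frame used for `u` depends only on its
line, never on the polytope, so all these sums run over one index set. -/

/-! ### Faces in a direction and Minkowski operations. -/

/-- The face of `S` on which the functional `⟪l, ·⟫` is maximal. -/
def faceIn (l : E3) (S : Set E3) : Set E3 :=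
  {x ∈ S | ∀ y ∈ S, inner ℝ l y ≤ inner ℝ l x}

theorem faceIn_subset (l : E3) (S : Set E3) : faceIn l S ⊆ S := fun _ hx => hx.1

theorem inner_eq_of_mem_faceIn {l : E3} {S : Set E3} {x y : E3} (hx : x ∈ faceIn l S)
    (hy : y ∈ faceIn l S) : inner ℝ l x = inner ℝ l y :=
  le_antisymm (hy.2 x hx.1) (hx.2 y hy.1)

theorem mem_faceIn_of_le {l : E3} {S : Set E3} {x p : E3} (hp : p ∈ faceIn l S) (hx : x ∈ S)
    (h : inner ℝ l p ≤ inner ℝ l x) : x ∈ faceIn l S :=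
  ⟨hx, fun y hy => (hp.2 y hy).trans h⟩

theorem faceIn_nonempty (l : E3) {S : Set E3} (hS : IsCompact S) (hne : S.Nonempty) :
    (faceIn l S).Nonempty := by
  obtain ⟨x, hx, h⟩ := hS.exists_isMaxOn hne
    (f := fun x => inner ℝ l x) (by fun_prop)
  exact ⟨x, hx, fun y hy => h hy⟩

theorem faceIn_isCompact (l : E3) {S : Set E3} (hS : IsCompact S) : IsCompact (faceIn l S) := by
  have h : faceIn l S = S ∩ ⋂ y ∈ S, {x | inner ℝ l y ≤ inner ℝ l x} := by
    ext x; simp [faceIn]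
  rw [h]
  refine hS.inter_right (isClosed_biInter fun y _ => ?_)
  exact isClosed_le (by fun_prop) (by fun_prop)

theorem faceIn_convex (l : E3) {S : Set E3} (hS : Convex ℝ S) : Convex ℝ (faceIn l S) := by
  intro x hx y hy a b ha hb hab
  refine ⟨hS hx.1 hy.1 ha hb hab, fun z hz => ?_⟩
  rw [inner_add_right, inner_smul_right, inner_smul_right, inner_eq_of_mem_faceIn hx hy,
    ← add_mul, hab, one_mul]
  exact hy.2 z hz

theorem faceIn_smul_left {c : ℝ} (hc : 0 < c) (l : E3) (S : Set E3) :
    faceIn (c • l) S = faceIn l S := by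
  ext x
  simp [faceIn, inner_smul_left, hc]

/-- A sum `x + y` is maximal only if both summands are. Compactness supplies maximisers of each
summand to compare with. -/
theorem faceIn_add (l : E3) {S T : Set E3} (hS : IsCompact S) (hS' : S.Nonempty)
    (hT : IsCompact T) (hT' : T.Nonempty) :
    faceIn l (S + T) = faceIn l S + faceIn l T := by
  ext z
  constructor
  · rintro ⟨⟨x, hx, y, hy, rfl⟩, h⟩
    obtain ⟨x', hx'⟩ := faceIn_nonempty l hS hS'
    obtain ⟨y', hy'⟩ := faceIn_nonempty l hT hT'
    have h1 := h _ (Set.add_mem_add hx'.1 hy)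
    have h2 := h _ (Set.add_mem_add hx hy'.1)
    simp only [inner_add_right] at h1 h2
    exact Set.add_mem_add (mem_faceIn_of_le hx' hx (by linarith))
      (mem_faceIn_of_le hy' hy (by linarith))
  · rintro ⟨x, hx, y, hy, rfl⟩
    refine ⟨Set.add_mem_add hx.1 hy.1, ?_⟩
    rintro _ ⟨x', hx', y', hy', rfl⟩
    simp only [inner_add_right]
    exact add_le_add (hx.2 _ hx') (hy.2 _ hy')

theorem faceIn_smul (l : E3) {t : ℝ} (ht : 0 ≤ t) {S : Set E3} (hS : IsCompact S)
    (hS' : S.Nonempty) : faceIn l (t • S) = t • faceIn l S := by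
  rcases ht.eq_or_lt with rfl | ht
  -- For `t = 0` both sides are `{0}`; on the right this needs the face to be nonempty.
  · rw [Set.zero_smul_set hS', Set.zero_smul_set (faceIn_nonempty l hS hS')]
    ext x
    simp +contextual [faceIn]
  · ext z
    constructor
    · rintro ⟨⟨x, hx, rfl⟩, h⟩
      refine Set.smul_mem_smul_set ⟨hx, fun y hy => ?_⟩
      have := h _ (Set.smul_mem_smul_set hy)
      simp only [inner_smul_right] at this
      exact le_of_mul_le_mul_left this ht
    · rintro ⟨x, hx, rfl⟩
      refine ⟨Set.smul_mem_smul_set hx.1, ?_⟩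
      rintro _ ⟨y, hy, rfl⟩
      simp only [inner_smul_right]
      exact mul_le_mul_of_nonneg_left (hx.2 y hy) ht.le

/-! ### Widths of flags. -/

/-- The width of `S` in the direction `u`. -/
noncomputable def widthAlong (u : E3) (S : Set E3) : ℝ :=
  sSup (innerSL ℝ u '' S) - sInf (innerSL ℝ u '' S)

theorem widthAlong_add (u : E3) {S T : Set E3} (hS : IsCompact S) (hS' : S.Nonempty)
    (hT : IsCompact T) (hT' : T.Nonempty) :
    widthAlong u (S + T) = widthAlong u S + widthAlong u T := by
  have h1 := hS.image (innerSL ℝ u).continuous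
  have h2 := hT.image (innerSL ℝ u).continuous
  unfold widthAlong
  rw [Set.image_add, csSup_add (hS'.image _) h1.bddAbove (hT'.image _) h2.bddAbove,
    csInf_add (hS'.image _) h1.bddBelow (hT'.image _) h2.bddBelow]
  ring

theorem widthAlong_smul (u : E3) {t : ℝ} (ht : 0 ≤ t) (S : Set E3) :
    widthAlong u (t • S) = t * widthAlong u S := by
  unfold widthAlong
  rw [image_smul_set, Real.sSup_smul_of_nonneg ht, Real.sInf_smul_of_nonneg ht]
  simp only [smul_eq_mul]
  ring

/-- The width along `u` of the face in direction `m` of the face in direction `n` of `P`. -/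
noncomputable def flagWidth (u n m : E3) (P : Set E3) : ℝ :=
  widthAlong u (faceIn m (faceIn n P))

theorem flagWidth_add (u n m : E3) {S T : Set E3} (hS : IsCompact S) (hS' : S.Nonempty)
    (hT : IsCompact T) (hT' : T.Nonempty) :
    flagWidth u n m (S + T) = flagWidth u n m S + flagWidth u n m T := by
  have a1 := faceIn_isCompact n hS
  have a2 := faceIn_nonempty n hS hS'
  have b1 := faceIn_isCompact n hT
  have b2 := faceIn_nonempty n hT hT'
  rw [flagWidth, faceIn_add n hS hS' hT hT', faceIn_add m a1 a2 b1 b2,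
    widthAlong_add u (faceIn_isCompact m a1) (faceIn_nonempty m a1 a2) (faceIn_isCompact m b1)
      (faceIn_nonempty m b1 b2), flagWidth, flagWidth]

theorem flagWidth_smul (u n m : E3) {t : ℝ} (ht : 0 ≤ t) {S : Set E3} (hS : IsCompact S)
    (hS' : S.Nonempty) : flagWidth u n m (t • S) = t * flagWidth u n m S := by
  rw [flagWidth, faceIn_smul n ht hS hS',
    faceIn_smul m ht (faceIn_isCompact n hS) (faceIn_nonempty n hS hS'), widthAlong_smul u ht,
    flagWidth]

/-! ### Closure of polytopes under Minkowski combinations, and linearity of flag widths. -/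

theorem IsConvexPolytope.isCompact {P : Set E3} (hP : IsConvexPolytope P) : IsCompact P := by
  obtain ⟨s, hs, -, rfl⟩ := hP
  exact hs.isCompact_convexHull ℝ

theorem IsConvexPolytope.nonempty {P : Set E3} (hP : IsConvexPolytope P) : P.Nonempty := by
  obtain ⟨s, -, hs, rfl⟩ := hP
  exact hs.convexHull

theorem IsConvexPolytope.convex {P : Set E3} (hP : IsConvexPolytope P) : Convex ℝ P := by
  obtain ⟨s, -, -, rfl⟩ := hP
  exact convex_convexHull ℝ s

theorem IsConvexPolytope.add {P Q : Set E3} (hP : IsConvexPolytope P) (hQ : IsConvexPolytope Q) :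
    IsConvexPolytope (P + Q) := by
  obtain ⟨s, hs, hs', rfl⟩ := hP
  obtain ⟨t, ht, ht', rfl⟩ := hQ
  exact ⟨s + t, hs.add ht, hs'.add ht', (convexHull_add s t).symm⟩

theorem IsConvexPolytope.smul {P : Set E3} (hP : IsConvexPolytope P) (c : ℝ) :
    IsConvexPolytope (c • P) := by
  obtain ⟨s, hs, hs', rfl⟩ := hP
  exact ⟨c • s, hs.smul_set, hs'.smul_set, (convexHull_smul c s).symm⟩

theorem isConvexPolytope_zero : IsConvexPolytope 0 :=
  ⟨0, Set.finite_zero, Set.zero_nonempty, by simp [← Set.singleton_zero]⟩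

theorem isConvexPolytope_sum {ι : Type*} (s : Finset ι) {P : ι → Set E3}
    (hP : ∀ i, IsConvexPolytope (P i)) (t : ι → ℝ) :
    IsConvexPolytope (∑ i ∈ s, t i • P i) :=
  Finset.sum_induction _ _ (fun _ _ => IsConvexPolytope.add) isConvexPolytope_zero
    fun i _ => (hP i).smul (t i)

theorem flagWidth_sum {ι : Type*} (u n m : E3) (s : Finset ι) {P : ι → Set E3}
    (hP : ∀ i, IsConvexPolytope (P i)) {t : ι → ℝ} (ht : ∀ i, 0 ≤ t i) :
    flagWidth u n m (∑ i ∈ s, t i • P i) = ∑ i ∈ s, t i * flagWidth u n m (P i) := by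
  classical
  induction s using Finset.induction_on with
  | empty =>
    have h0 := isConvexPolytope_zero
    -- The empty sum is `0 = 0 • 0`, so homogeneity gives it width zero.
    have := flagWidth_smul u n m le_rfl h0.isCompact h0.nonempty
    rw [Set.zero_smul_set h0.nonempty, zero_mul] at this
    simpa using this
  | insert i s hi ih =>
    have h1 := (hP i).smul (t i)
    have h2 := isConvexPolytope_sum s hP t
    rw [Finset.sum_insert hi, Finset.sum_insert hi,
      flagWidth_add u n m h1.isCompact h1.nonempty h2.isCompact h2.nonempty, ih,
      flagWidth_smul u n m (ht i) (hP i).isCompact (hP i).nonempty]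

/-! ### Faces of faces and supporting functionals. -/

/-- An inequality between affine functionals passes from the vertices of a polytope to the
polytope. -/
theorem inner_sub_le_of_forall_mem {s : Set E3} {l p : E3} {c : ℝ}
    (h : ∀ v ∈ s, inner ℝ l (v - p) ≤ c) {x : E3} (hx : x ∈ convexHull ℝ s) :
    inner ℝ l (x - p) ≤ c := by
  have hc : Convex ℝ {x : E3 | inner ℝ l (x - p) ≤ c} := by
    have : {x : E3 | inner ℝ l (x - p) ≤ c} = {x | innerSL ℝ l x ≤ c + inner ℝ l p} := by
      ext x
      simp [inner_sub_right]
    rw [this]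
    exact convex_halfSpace_le (innerSL ℝ l).toLinearMap.isLinear _
  exact convexHull_min (t := {x : E3 | inner ℝ l (x - p) ≤ c}) h hc hx

/-- A face of a face of a polytope is a face. -/
theorem exists_faceIn_eq_faceIn_faceIn {P : Set E3} (hP : IsConvexPolytope P) (n m : E3) :
    ∃ l, faceIn l P = faceIn m (faceIn n P) := by
  have hF := faceIn_isCompact n hP.isCompact
  obtain ⟨p, hp⟩ := faceIn_nonempty m hF (faceIn_nonempty n hP.isCompact hP.nonempty)
  obtain ⟨s, hs, -, rfl⟩ := hP
  -- The face sought is that of `n + ε • m` for small `ε`. The factor `2` leaves room: `⟪n + ε • m,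
  -- x - p⟫ ≤ ⟪n, x - p⟫ / 2`, so equality with `0` forces `x` into the face of `n`.
  have key : ∃ ε : ℝ, 0 < ε ∧ ∀ v ∈ s,
      2 * ε * inner ℝ m (v - p) ≤ - inner ℝ n (v - p) := by
    -- Each bound persists for smaller `δ`, so the minimum over the finitely many vertices serves
    -- them all.
    have hv : ∀ v ∈ s, ∃ ε : ℝ, 0 < ε ∧ ∀ δ : ℝ, 0 < δ → δ ≤ ε →
        2 * δ * inner ℝ m (v - p) ≤ - inner ℝ n (v - p) := by
      intro v hv
      have hvP := subset_convexHull ℝ s hv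
      have h1 : inner ℝ n (v - p) ≤ 0 := by
        rw [inner_sub_right]; linarith [hp.1.2 v hvP]
      by_cases hm : inner ℝ m (v - p) ≤ 0
      · exact ⟨1, one_pos, fun δ hδ _ => by nlinarith⟩
      · push Not at hm
        have h2 : inner ℝ n (v - p) < 0 := by
          refine lt_of_le_of_ne h1 fun h => ?_
          have := hp.2 v (mem_faceIn_of_le hp.1 hvP (by rw [inner_sub_right] at h; linarith))
          rw [inner_sub_right] at hm
          linarith
        refine ⟨- inner ℝ n (v - p) / (2 * inner ℝ m (v - p)),
          div_pos (by linarith) (by linarith), fun δ _ hδ' => ?_⟩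
        rw [le_div_iff₀ (by linarith)] at hδ'
        linarith
    choose! ε hε hε' using hv
    rcases s.eq_empty_or_nonempty with rfl | hne
    · exact ⟨1, one_pos, by simp⟩
    · obtain ⟨v₀, hv₀, hmin⟩ := Set.exists_min_image s ε hs hne
      exact ⟨ε v₀, hε v₀ hv₀, fun v hv => hε' v hv _ (hε v₀ hv₀) (hmin v hv)⟩
  obtain ⟨ε, hε, hs'⟩ := key
  have hall : ∀ x ∈ convexHull ℝ s, 2 * ε * inner ℝ m (x - p) ≤ - inner ℝ n (x - p) := by
    intro x hx
    have := inner_sub_le_of_forall_mem (l := (2 * ε) • m + n) (p := p) (c := 0) (s := s)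
      (fun v hv => by
        rw [inner_add_left, real_inner_smul_left]; linarith [hs' v hv]) hx
    rw [inner_add_left, real_inner_smul_left] at this
    linarith
  have hpl : p ∈ faceIn (n + ε • m) (convexHull ℝ s) := by
    refine ⟨hp.1.1, fun x hx => ?_⟩
    have h1 := hall x hx
    have h2 := hp.1.2 x hx
    simp only [inner_sub_right, inner_add_left, real_inner_smul_left] at *
    nlinarith
  refine ⟨n + ε • m, Set.Subset.antisymm (fun x hx => ?_) fun x hx => ?_⟩
  · have h1 := hall x hx.1
    have h2 := hp.1.2 x hx.1
    have h3 := inner_eq_of_mem_faceIn hx hpl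
    simp only [inner_sub_right, inner_add_left, real_inner_smul_left] at *
    have hn : inner ℝ n p ≤ inner ℝ n x := by nlinarith
    exact mem_faceIn_of_le hp (mem_faceIn_of_le hp.1 hx.1 hn)
      (le_of_mul_le_mul_left (by nlinarith) hε)
  · refine mem_faceIn_of_le hpl hx.1.1 ?_
    have h3 := inner_eq_of_mem_faceIn hx.1 hp.1
    have h4 := inner_eq_of_mem_faceIn hx hp
    simp only [inner_add_left, real_inner_smul_left, h3, h4, le_refl]

theorem faceIn_isExposed (l : E3) (S : Set E3) : IsExposed ℝ S (faceIn l S) :=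
  fun _ => ⟨innerSL ℝ l, rfl⟩

theorem exists_eq_faceIn_of_mem_polytopeEdges {P e : Set E3} (he : e ∈ polytopeEdges P) :
    ∃ l, e = faceIn l P := by
  obtain ⟨hexp, a, b, -, rfl⟩ := he
  obtain ⟨l, hl⟩ := hexp ⟨a, left_mem_segment ℝ a b⟩
  refine ⟨(InnerProductSpace.toDual ℝ E3).symm l, ?_⟩
  simpa [faceIn] using hl

/-! ### Frames and angles in the plane orthogonal to an edge. -/

/-- The unit vector at angle `θ` in the plane spanned by the last two vectors of the frame `b`. -/
noncomputable def planeDir (b : OrthonormalBasis (Fin 3) ℝ E3) (θ : Real.Angle) : E3 :=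
  θ.cos • b 1 + θ.sin • b 2

section Frames

variable (b : OrthonormalBasis (Fin 3) ℝ E3)

theorem inner_eq_sum_coords (x y : E3) :
    inner ℝ x y = inner ℝ (b 0) x * inner ℝ (b 0) y + inner ℝ (b 1) x * inner ℝ (b 1) y
      + inner ℝ (b 2) x * inner ℝ (b 2) y := by
  rw [← b.sum_inner_mul_inner x y, Fin.sum_univ_three]
  simp only [real_inner_comm]

theorem inner_frame (i j : Fin 3) : inner ℝ (b i) (b j) = if i = j then (1 : ℝ) else 0 :=
  orthonormal_iff_ite.1 b.orthonormal i j

theorem ext_coords {x y : E3} (h0 : inner ℝ (b 0) x = inner ℝ (b 0) y)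
    (h1 : inner ℝ (b 1) x = inner ℝ (b 1) y) (h2 : inner ℝ (b 2) x = inner ℝ (b 2) y) : x = y := by
  refine InnerProductSpace.ext_inner_left_basis b.toBasis fun i => ?_
  fin_cases i
  · simpa using h0
  · simpa using h1
  · simpa using h2

theorem inner_planeDir (θ : Real.Angle) (x : E3) :
    inner ℝ (planeDir b θ) x = θ.cos * inner ℝ (b 1) x + θ.sin * inner ℝ (b 2) x := by
  simp [planeDir, inner_add_left, real_inner_smul_left]

theorem planeDir_add_pi_div_two (θ : Real.Angle) :
    planeDir b (θ + (Real.pi / 2 : ℝ)) = (-θ.sin) • b 1 + θ.cos • b 2 := by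
  simp [planeDir, Real.Angle.cos_add, Real.Angle.sin_add]

theorem planeDir_sub_pi_div_two (θ : Real.Angle) :
    planeDir b (θ - (Real.pi / 2 : ℝ)) = θ.sin • b 1 + (-θ.cos) • b 2 := by
  simp [planeDir, sub_eq_add_neg, Real.Angle.cos_add, Real.Angle.sin_add]

theorem planeDir_sub_eq_neg (θ : Real.Angle) :
    planeDir b (θ - (Real.pi / 2 : ℝ)) = -planeDir b (θ + (Real.pi / 2 : ℝ)) := by
  rw [planeDir_add_pi_div_two, planeDir_sub_pi_div_two, neg_add, neg_smul, neg_smul, neg_neg]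

/-- This allows any direction orthogonal to `b 0` to be taken as the second vector of the frame. -/
theorem exists_frame_rotate (θ : Real.Angle) : ∃ b' : OrthonormalBasis (Fin 3) ℝ E3,
    b' 0 = b 0 ∧ ∀ ψ, planeDir b' ψ = planeDir b (θ + ψ) := by
  have hcs := θ.cos_sq_add_sin_sq
  have ho : Orthonormal ℝ ![b 0, planeDir b θ, planeDir b (θ + (Real.pi / 2 : ℝ))] := by
    rw [orthonormal_iff_ite]
    intro i j
    have h0 : ∀ φ, inner ℝ (planeDir b φ) (b 0) = 0 := fun φ => by simp [inner_planeDir]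
    have h0' : ∀ φ, inner ℝ (b 0) (planeDir b φ) = 0 := fun φ => by rw [real_inner_comm, h0]
    have h1 : ∀ φ φ', inner ℝ (planeDir b φ) (planeDir b φ')
        = φ.cos * φ'.cos + φ.sin * φ'.sin := fun φ φ' => by
      rw [inner_planeDir, real_inner_comm, inner_planeDir, real_inner_comm (planeDir b φ'),
        inner_planeDir]
      simp
    fin_cases i <;> fin_cases j <;>
      simp [h0, h0', h1, Real.Angle.cos_add, Real.Angle.sin_add,
        -inner_self_eq_norm_sq_to_K, inner_frame] <;> nlinarith
  obtain ⟨b', hb'⟩ := Orthonormal.exists_orthonormalBasis_extension_of_card_eq (𝕜 := ℝ) (E := E3)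
    (ι := Fin 3) (by simp) (v := ![b 0, planeDir b θ, planeDir b (θ + (Real.pi / 2 : ℝ))])
    (s := Set.univ) (ho.comp _ Subtype.val_injective)
  have h0 := hb' 0 trivial
  have h1 := hb' 1 trivial
  have h2 := hb' 2 trivial
  simp only [Matrix.cons_val] at h0 h1 h2
  refine ⟨b', h0, fun ψ => ?_⟩
  rw [planeDir, h1, h2, planeDir_add_pi_div_two]
  simp only [planeDir, Real.Angle.cos_add, Real.Angle.sin_add]
  module

theorem exists_planeDir_smul {l : E3} (hl : l ≠ 0) (h0 : inner ℝ (b 0) l = 0) :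
    ∃ (θ : Real.Angle) (c : ℝ), 0 < c ∧ l = c • planeDir b θ := by
  set z : ℂ := ⟨inner ℝ (b 1) l, inner ℝ (b 2) l⟩ with hz
  have hlz : l = z.re • b 1 + z.im • b 2 := by
    apply ext_coords b <;>
      simp [inner_add_right, real_inner_smul_right, h0, hz]
  have hz0 : z ≠ 0 := by
    intro h
    apply hl
    rw [hlz, h]
    simp
  refine ⟨z.arg, ‖z‖, norm_pos_iff.2 hz0, ?_⟩
  rw [planeDir, smul_add, smul_smul, smul_smul, Real.Angle.cos_coe, Real.Angle.sin_coe,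
    Complex.norm_mul_cos_arg, Complex.norm_mul_sin_arg, ← hlz]

/-- A compact convex set on a line is a segment, whose length is its width. -/
theorem eq_segment_of_subset_line {S : Set E3} (hc : IsCompact S) (hne : S.Nonempty)
    (hconv : Convex ℝ S) (h1 : ∀ x ∈ S, ∀ y ∈ S, inner ℝ (b 1) x = inner ℝ (b 1) y)
    (h2 : ∀ x ∈ S, ∀ y ∈ S, inner ℝ (b 2) x = inner ℝ (b 2) y) :
    ∃ a, ∃ w : ℝ, 0 ≤ w ∧ S = segment ℝ a (a + w • b 0) ∧ widthAlong (b 0) S = w := by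
  obtain ⟨p, hp, hpmin⟩ := hc.exists_isMinOn hne (f := fun x => inner ℝ (b 0) x) (by fun_prop)
  obtain ⟨q, hq, hqmax⟩ := hc.exists_isMaxOn hne (f := fun x => inner ℝ (b 0) x) (by fun_prop)
  set w : ℝ := inner ℝ (b 0) q - inner ℝ (b 0) p with hw
  have hw0 : 0 ≤ w := sub_nonneg.2 (hpmin hq)
  have hline : ∀ x ∈ S, x = p + (inner ℝ (b 0) x - inner ℝ (b 0) p) • b 0 := by
    intro x hx
    apply ext_coords b <;>
      simp [inner_add_right, real_inner_smul_right, h1 x hx p hp, h2 x hx p hp]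
  refine ⟨p, w, hw0, Set.Subset.antisymm (fun x hx => ?_) ?_, ?_⟩
  · rw [hline x hx]
    set t : ℝ := inner ℝ (b 0) x - inner ℝ (b 0) p with ht
    have ht0 : 0 ≤ t := sub_nonneg.2 (hpmin hx)
    have htw : t ≤ w := sub_le_sub_right (hqmax hx) _
    rcases hw0.eq_or_lt with h | h
    · have : t = 0 := by linarith
      rw [this, zero_smul, add_zero]
      exact left_mem_segment ℝ _ _
    · rw [segment_eq_image']
      refine ⟨t / w, ⟨by positivity, (div_le_one h).2 htw⟩, ?_⟩
      simp [smul_smul, div_mul_cancel₀ t h.ne']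
  · rw [← hline q hq]
    exact hconv.segment_subset hp hq
  · have hmax : IsGreatest (innerSL ℝ (b 0) '' S) (inner ℝ (b 0) q) :=
      ⟨⟨q, hq, rfl⟩, by rintro _ ⟨x, hx, rfl⟩; exact hqmax hx⟩
    have hmin : IsLeast (innerSL ℝ (b 0) '' S) (inner ℝ (b 0) p) :=
      ⟨⟨p, hp, rfl⟩, by rintro _ ⟨x, hx, rfl⟩; exact hpmin hx⟩
    rw [widthAlong, hmax.csSup_eq, hmin.csInf_eq]

theorem diam_segment (a c : E3) : Metric.diam (segment ℝ a c) = dist a c := by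
  rw [← convexHull_pair, convexHull_diam, Metric.diam_pair]

/-- Polar angles are measured from `-b 1` towards `b 2`: for an edge exposed by `b 1`, the rest of
the polytope lies where `b 1` is smaller, so its angles stay in `(-π/2, π/2)`. -/
theorem angle_eq_abs_sub {v w : E3} {ρ σ A B : ℝ} (hρ : 0 < ρ) (hσ : 0 < σ)
    (hv0 : inner ℝ (b 0) v = 0) (hv1 : inner ℝ (b 1) v = -(ρ * Real.cos A))
    (hv2 : inner ℝ (b 2) v = ρ * Real.sin A)
    (hw0 : inner ℝ (b 0) w = 0) (hw1 : inner ℝ (b 1) w = -(σ * Real.cos B))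
    (hw2 : inner ℝ (b 2) w = σ * Real.sin B) (hAB : |A - B| ≤ Real.pi) :
    InnerProductGeometry.angle v w = |A - B| := by
  have hA := Real.sin_sq_add_cos_sq A
  have hB := Real.sin_sq_add_cos_sq B
  have hv : ‖v‖ = ρ := by
    rw [← sq_eq_sq₀ (norm_nonneg v) hρ.le, ← real_inner_self_eq_norm_sq, inner_eq_sum_coords b,
      hv0, hv1, hv2]
    linear_combination ρ ^ 2 * hA
  have hw : ‖w‖ = σ := by
    rw [← sq_eq_sq₀ (norm_nonneg w) hσ.le, ← real_inner_self_eq_norm_sq, inner_eq_sum_coords b,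
      hw0, hw1, hw2]
    linear_combination σ ^ 2 * hB
  have hvw : inner ℝ v w = Real.cos |A - B| * (ρ * σ) := by
    rw [inner_eq_sum_coords b, hv0, hv1, hv2, hw1, hw2, Real.cos_abs, Real.cos_sub]
    ring
  rw [InnerProductGeometry.angle, hv, hw, hvw, mul_div_cancel_right₀ _ (by positivity),
    Real.arccos_cos (abs_nonneg _) hAB]

end Frames

theorem exists_polar_of_neg {x y : ℝ} (hx : x < 0) : ∃ ρ A : ℝ, 0 < ρ ∧
    -(Real.pi / 2) < A ∧ A < Real.pi / 2 ∧ x = -(ρ * Real.cos A) ∧ y = ρ * Real.sin A := by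
  have hc := Real.cos_arctan_pos (y / -x)
  refine ⟨-x / Real.cos (Real.arctan (y / -x)), Real.arctan (y / -x),
    div_pos (by linarith) hc, Real.neg_pi_div_two_lt_arctan _, Real.arctan_lt_pi_div_two _, ?_, ?_⟩
  · field_simp
  · rw [div_mul_eq_mul_div, mul_div_assoc, ← Real.tan_eq_sin_div_cos, Real.tan_arctan, mul_div_cancel₀ _ (by linarith)]

/-! ### The shadow of a polytope at a face and its bounding ray. -/

/-- The two-dimensional shadow of a polytope at a face `e = faceIn l P` through `p`: the ray at
angle `A` from `-l` towards `m` bounds the shadow from the side of `-m` and contains the shadow of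
a point of `P` outside `e`. -/
structure IsLowerRay (P e : Set E3) (l m p : E3) (A : ℝ) : Prop where
  neg_lt : -(Real.pi / 2) < A
  lt : A < Real.pi / 2
  nonneg : ∀ v ∈ P, 0 ≤ Real.cos A * inner ℝ m (v - p) + Real.sin A * inner ℝ l (v - p)
  attained : ∃ w ∈ P, w ∉ e ∧
    Real.cos A * inner ℝ m (w - p) + Real.sin A * inner ℝ l (w - p) = 0

theorem inner_sub_neg_of_notMem {P : Set E3} {l p v : E3} (hp : p ∈ faceIn l P) (hv : v ∈ P)
    (hve : v ∉ faceIn l P) : inner ℝ l (v - p) < 0 := by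
  rw [inner_sub_right, sub_neg]
  by_contra! h
  exact hve (mem_faceIn_of_le hp hv h)

/-- The ray passes through the vertex off the face with the least slope `⟪m, v - p⟫ / -⟪l, v - p⟫`.
The half-plane above it contains the shadow of every vertex, hence of the hull. -/
theorem exists_isLowerRay {P : Set E3} (hP : IsConvexPolytope P) {l m p : E3}
    (hp : p ∈ faceIn l P) (hm : ∀ v ∈ faceIn l P, inner ℝ m (v - p) = 0)
    (hne : faceIn l P ≠ P) : ∃ A, IsLowerRay P (faceIn l P) l m p A := by
  have hconv := faceIn_convex l hP.convex
  obtain ⟨s, hs, -, rfl⟩ := hP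
  have hs' : (s \ faceIn l (convexHull ℝ s)).Nonempty := by
    rw [Set.sdiff_nonempty]
    exact fun h => hne ((faceIn_subset _ _).antisymm (convexHull_min h hconv))
  obtain ⟨w, ⟨hws, hwe⟩, hmin⟩ := Set.exists_min_image _
    (fun v => inner ℝ m (v - p) / -inner ℝ l (v - p)) (hs.subset Set.sdiff_subset) hs'
  have hneg : ∀ v ∈ s, v ∉ faceIn l (convexHull ℝ s) → inner ℝ l (v - p) < 0 :=
    fun v hv => inner_sub_neg_of_notMem hp (subset_convexHull ℝ s hv)
  set τ := inner ℝ m (w - p) / -inner ℝ l (w - p) with hτ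
  have hsin : Real.sin (Real.arctan τ) = τ * Real.cos (Real.arctan τ) := by
    rw [← Real.tan_mul_cos (Real.cos_arctan_pos τ).ne', Real.tan_arctan]
  have hcos := Real.cos_arctan_pos τ
  refine ⟨Real.arctan τ, Real.neg_pi_div_two_lt_arctan _, Real.arctan_lt_pi_div_two _,
    fun x hx => ?_, w, subset_convexHull ℝ s hws, hwe, ?_⟩
  · have hx' := inner_sub_le_of_forall_mem (l := (-τ) • l + (-1 : ℝ) • m) (p := p) (c := 0)
      (fun v hv => ?_) hx
    · rw [inner_add_left, real_inner_smul_left, real_inner_smul_left] at hx'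
      rw [hsin]
      nlinarith
    · rw [inner_add_left, real_inner_smul_left, real_inner_smul_left]
      by_cases hve : v ∈ faceIn l (convexHull ℝ s)
      · rw [hm v hve, inner_sub_right, inner_eq_of_mem_faceIn hve hp]
        simp
      · have h1 := hmin v ⟨hv, hve⟩
        have h2 := hneg v hv hve
        rw [le_div_iff₀ (by linarith)] at h1
        linarith
  · have h2 := hneg w hws hwe
    have : inner ℝ m (w - p) = τ * -inner ℝ l (w - p) := by
      rw [hτ, div_mul_cancel₀ _ (by linarith)]
    rw [hsin, this]
    ring

/-- Exactly one supporting direction `n` orthogonal to an edge has a face strictly larger than the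
edge, whose face in the direction `n` turned by a right angle is the edge. -/
theorem IsLowerRay.faceIn_faceIn_eq_iff {P e : Set E3} {l m p : E3} {A : ℝ}
    (h : IsLowerRay P e l m p A) (he : e = faceIn l P) (hp : p ∈ e)
    (hm : ∀ v ∈ e, inner ℝ m (v - p) = 0) (ψ : Real.Angle) :
    (faceIn ((-ψ.sin) • l + ψ.cos • m) (faceIn (ψ.cos • l + ψ.sin • m) P) = e ∧
      faceIn (ψ.cos • l + ψ.sin • m) P ≠ e) ↔ ψ = ((-(Real.pi / 2) - A : ℝ) : Real.Angle) := by
  obtain ⟨w, hw, hwe, hweq⟩ := h.attained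
  have hcosA : 0 < Real.cos A := Real.cos_pos_of_mem_Ioo ⟨h.neg_lt, h.lt⟩
  have hcs := Real.sin_sq_add_cos_sq A
  have hneg : ∀ v ∈ P, v ∉ e → inner ℝ l (v - p) < 0 := by
    rintro v hv hve
    subst he
    exact inner_sub_neg_of_notMem hp hv hve
  have hzero : ∀ v ∈ e, inner ℝ l (v - p) = 0 := by
    rintro v hv
    subst he
    rw [inner_sub_right, inner_eq_of_mem_faceIn hv hp, sub_self]
  have hePsub : e ⊆ P := he ▸ faceIn_subset l P
  set n := ψ.cos • l + ψ.sin • m with hn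
  set k := (-ψ.sin) • l + ψ.cos • m with hk
  have hni : ∀ v, inner ℝ n v = ψ.cos * inner ℝ l v + ψ.sin * inner ℝ m v := fun v => by
    simp [hn, inner_add_left, real_inner_smul_left]
  have hki : ∀ v, inner ℝ k v = -ψ.sin * inner ℝ l v + ψ.cos * inner ℝ m v := fun v => by
    simp [hk, inner_add_left, real_inner_smul_left]
  constructor
  · rintro ⟨h1, h2⟩
    have hsub : e ⊆ faceIn n P := h1 ▸ faceIn_subset _ _
    obtain ⟨x, hxn, hxe⟩ : ∃ x ∈ faceIn n P, x ∉ e := by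
      by_contra! hcon
      exact h2 (Set.Subset.antisymm hcon hsub)
    have hpn := hsub hp
    have hpk : p ∈ faceIn k (faceIn n P) := h1.symm ▸ hp
    have e1 : inner ℝ n (x - p) = 0 := by
      rw [inner_sub_right, inner_eq_of_mem_faceIn hxn hpn, sub_self]
    have e2 : inner ℝ k (x - p) < 0 :=
      inner_sub_neg_of_notMem hpk hxn (by rwa [h1])
    have e3 : inner ℝ n (w - p) ≤ 0 := by
      rw [inner_sub_right]
      linarith [hpn.2 w hw]
    have e4 := h.nonneg x hxn.1
    have hxl := hneg x hxn.1 hxe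
    have hwl := hneg w hw hwe
    rw [hni] at e1 e3
    rw [hki] at e2
    generalize inner ℝ l (x - p) = x1 at *
    generalize inner ℝ m (x - p) = x2 at *
    generalize inner ℝ l (w - p) = w1 at *
    generalize inner ℝ m (w - p) = w2 at *
    induction ψ using Real.Angle.induction_on with
    | _ ψ =>
    simp only [Real.Angle.cos_coe, Real.Angle.sin_coe] at *
    have hcs' := Real.sin_sq_add_cos_sq ψ
    -- Since `x - p` is orthogonal to `n`, its shadow is `-ρ • k`.
    set ρ := -(-Real.sin ψ * x1 + Real.cos ψ * x2) with hρ
    have hρ0 : 0 < ρ := by linarith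
    have hx1 : x1 = ρ * Real.sin ψ := by
      rw [hρ]; linear_combination (-x1) * hcs' + Real.cos ψ * e1
    have hx2 : x2 = -(ρ * Real.cos ψ) := by
      rw [hρ]; linear_combination (-x2) * hcs' + Real.sin ψ * e1
    have hsinψ : Real.sin ψ < 0 := by
      by_contra! hcon
      nlinarith [mul_nonneg hρ0.le hcon]
    -- `x` lies above the ray, which bounds `cos (ψ + A)` from above; `w` lies on the ray and below
    -- the support line of `n`, which bounds it from below.
    have c1 : Real.cos (ψ + A) ≤ 0 := by
      rw [Real.cos_add]
      rw [hx1, hx2] at e4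
      by_contra! hcon
      nlinarith [mul_pos hρ0 hcon]
    have c2 : 0 ≤ Real.cos (ψ + A) := by
      rw [Real.cos_add]
      by_contra! hcon
      have : w1 * (Real.cos ψ * Real.cos A - Real.sin ψ * Real.sin A) =
          Real.cos A * (Real.cos ψ * w1 + Real.sin ψ * w2) := by
        linear_combination (-Real.sin ψ) * hweq
      nlinarith [mul_pos_of_neg_of_neg hwl hcon]
    have c3 : Real.Angle.cos ((ψ + A : ℝ) : Real.Angle) = 0 := by
      rw [Real.Angle.cos_coe]; exact le_antisymm c1 c2
    -- The value `π/2` would give `sin ψ = cos A > 0`, against `hsinψ`.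
    rcases Real.Angle.cos_eq_zero_iff.1 c3 with c | c
    · exfalso
      have hψ : (ψ : Real.Angle) = ((Real.pi / 2 - A : ℝ) : Real.Angle) := by
        rw [Real.Angle.coe_sub, ← c, Real.Angle.coe_add, add_sub_cancel_right]
      have := congrArg Real.Angle.sin hψ
      rw [Real.Angle.sin_coe, Real.Angle.sin_coe, Real.sin_pi_div_two_sub] at this
      linarith
    · rw [Real.Angle.coe_sub, ← neg_div, ← c, Real.Angle.coe_add, add_sub_cancel_right]
  · intro hψ
    have hs : ψ.sin = -Real.cos A := by
      rw [hψ, Real.Angle.sin_coe, ← neg_add', Real.sin_neg, add_comm, Real.sin_add_pi_div_two]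
    have hc : ψ.cos = -Real.sin A := by
      rw [hψ, Real.Angle.cos_coe, ← neg_add', Real.cos_neg, add_comm, Real.cos_add_pi_div_two]
    have hn_le : ∀ v ∈ P, inner ℝ n (v - p) ≤ 0 := fun v hv => by
      rw [hni, hs, hc]; linarith [h.nonneg v hv]
    have hpn : p ∈ faceIn n P := ⟨hePsub hp, fun v hv => by
      have := hn_le v hv
      rw [inner_sub_right] at this
      linarith⟩
    have hen : ∀ v ∈ e, v ∈ faceIn n P := fun v hv => by
      refine mem_faceIn_of_le hpn (hePsub hv) (le_of_eq ?_)
      have : inner ℝ n (v - p) = 0 := by rw [hni, hzero v hv, hm v hv]; simp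
      rw [inner_sub_right] at this
      linarith
    -- On the face of `n`, the functionals of `k` and `l` are proportional with factor `cos A > 0`,
    -- so `k` selects the points where `l` is maximal, which is `e`.
    have hkv : ∀ v ∈ faceIn n P, Real.cos A * inner ℝ k (v - p) = inner ℝ l (v - p) := by
      intro v hv
      have e1 : inner ℝ n (v - p) = 0 := by
        rw [inner_sub_right, inner_eq_of_mem_faceIn hv hpn, sub_self]
      rw [hni, hs, hc] at e1
      rw [hki, hs, hc]
      linear_combination Real.sin A * e1 + inner ℝ l (v - p) * hcs
    have hle : ∀ v ∈ P, inner ℝ l (v - p) ≤ 0 := fun v hv => by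
      by_cases hve : v ∈ e
      · exact (hzero v hve).le
      · exact (hneg v hv hve).le
    have hpk : p ∈ faceIn k (faceIn n P) := ⟨hpn, fun v hv => by
      have h1 := hkv v hv
      have h2 := hle v hv.1
      rw [inner_sub_right] at h1
      nlinarith⟩
    refine ⟨Set.Subset.antisymm (fun v hv => ?_) fun v hv => ?_, fun hcon => ?_⟩
    · by_contra hve
      have h1 := hkv v hv.1
      have h2 := hneg v hv.1.1 hve
      rw [inner_sub_right, inner_eq_of_mem_faceIn hv hpk, sub_self, mul_zero] at h1
      linarith
    · refine mem_faceIn_of_le hpk (hen v hv) ?_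
      have h1 := hkv v (hen v hv)
      rw [hzero v hv, inner_sub_right] at h1
      nlinarith
    · apply hwe
      rw [← hcon]
      refine mem_faceIn_of_le hpn hw ?_
      have : inner ℝ n (w - p) = 0 := by rw [hni, hs, hc]; linarith
      rw [inner_sub_right] at this
      linarith

/-! ### The dihedral angle as the angle between the two bounding rays. -/

section Dihedral

variable {b : OrthonormalBasis (Fin 3) ℝ E3} {P e : Set E3} {a : E3} {A B : ℝ}

/-- The two half-planes say `sin (C - A) ≥ 0` and `sin (C + B) ≤ 0`, with both arguments in `(-π,
π)`. As `B` is measured towards `-b 2`, the upper ray is at `-B`. -/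
theorem IsLowerRay.exists_polar (hA : IsLowerRay P e (b 1) (b 2) a A)
    (hB : IsLowerRay P e (b 1) (-b 2) a B) (he : e = faceIn (b 1) P) (ha : a ∈ e)
    {p x : E3} (hp : p ∈ e) (hp2 : inner ℝ (b 2) p = inner ℝ (b 2) a) (hx : x ∈ P)
    (hxe : x ∉ e) :
    ∃ ρ C : ℝ, 0 < ρ ∧ A ≤ C ∧ C ≤ -B ∧ inner ℝ (b 1) (x - p) = -(ρ * Real.cos C) ∧
      inner ℝ (b 2) (x - p) = ρ * Real.sin C := by
  have hneg : inner ℝ (b 1) (x - p) < 0 := by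
    subst he
    exact inner_sub_neg_of_notMem hp hx hxe
  have hp1 : inner ℝ (b 1) p = inner ℝ (b 1) a := by
    subst he
    exact inner_eq_of_mem_faceIn hp ha
  obtain ⟨ρ, C, hρ, hC1, hC2, h1, h2⟩ := exists_polar_of_neg hneg (y := inner ℝ (b 2) (x - p))
  have e1 := hA.nonneg x hx
  have e2 := hB.nonneg x hx
  have hA1 := hA.neg_lt
  have hA2 := hA.lt
  have hB1 := hB.neg_lt
  have hB2 := hB.lt
  rw [inner_sub_right, hp1, ← inner_sub_right] at h1
  rw [inner_sub_right, hp2, ← inner_sub_right] at h2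
  rw [inner_neg_left] at e2
  rw [h1, h2] at e1 e2
  refine ⟨ρ, C, hρ, ?_, ?_, by rw [inner_sub_right, hp1, ← inner_sub_right, h1],
    by rw [inner_sub_right, hp2, ← inner_sub_right, h2]⟩
  · by_contra! hcon
    have := Real.sin_neg_of_neg_of_neg_pi_lt (x := C - A) (by linarith) (by linarith)
    rw [Real.sin_sub] at this
    nlinarith [mul_neg_of_pos_of_neg hρ this]
  · by_contra! hcon
    have := Real.sin_pos_of_pos_of_lt_pi (x := C + B) (by linarith) (by linarith)
    rw [Real.sin_add] at this
    nlinarith [mul_pos hρ this]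

/-- Every point of `P` casts its shadow, shrunk, in the plane orthogonal to an edge through its
midpoint. -/
theorem exists_mem_orthogonal_section (hconv : Convex ℝ P) {w : ℝ} (hw : 0 < w)
    (hsub : segment ℝ a (a + w • b 0) ⊆ P) {v : E3} (hv : v ∈ P) :
    ∃ ε : ℝ, 0 < ε ∧ ∃ x ∈ P, inner ℝ (b 0) (x - (a + (w / 2) • b 0)) = 0 ∧
      inner ℝ (b 1) (x - (a + (w / 2) • b 0)) = ε * inner ℝ (b 1) (v - a) ∧
      inner ℝ (b 2) (x - (a + (w / 2) • b 0)) = ε * inner ℝ (b 2) (v - a) := by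
  set c : ℝ := inner ℝ (b 0) (v - (a + (w / 2) • b 0)) with hc
  -- The summand `1` keeps `ε < 1` even when `c = 0`.
  set D : ℝ := w / 2 + |c| + 1 with hD
  have hD0 : 0 < D := by positivity
  set ε : ℝ := (w / 2) / D with hε
  have hε0 : 0 < ε := by positivity
  have hε1 : 1 - ε = (|c| + 1) / D := by
    rw [hε, hD]; field_simp; ring
  have hpos : 0 < 1 - ε := by rw [hε1]; positivity
  -- `t` solves `(1 - ε) (t - w / 2) + ε c = 0`, so mixing `v` with this edge point lands in the
  -- section through the midpoint; the choice of `ε` keeps `t` in `[0, w]`.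
  set t : ℝ := w / 2 - ε * c / (1 - ε) with ht
  have hεc : |ε * c / (1 - ε)| ≤ w / 2 := by
    rw [abs_div, abs_mul, abs_of_pos hε0, abs_of_pos hpos, hε1, hε]
    have : w / 2 / D * |c| / ((|c| + 1) / D) = w / 2 * (|c| / (|c| + 1)) := by field_simp
    rw [this]
    have h1 : |c| / (|c| + 1) ≤ 1 := (div_le_one (by positivity)).2 (by linarith)
    nlinarith
  obtain ⟨h1, h2⟩ := abs_le.1 hεc
  have hq : a + t • b 0 ∈ P := by
    apply hsub
    rw [segment_eq_image']
    refine ⟨t / w, ⟨div_nonneg (by linarith) hw.le, (div_le_one hw).2 (by linarith)⟩, ?_⟩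
    simp [smul_smul, div_mul_cancel₀ t hw.ne']
  refine ⟨ε, hε0, (1 - ε) • (a + t • b 0) + ε • v,
    hconv hq hv hpos.le hε0.le (by ring), ?_, ?_, ?_⟩
  · have : (1 - ε) * t = (1 - ε) * (w / 2) - ε * c := by
      rw [ht, mul_sub, mul_div_cancel₀ _ hpos.ne']
    simp only [inner_sub_right, inner_add_right, real_inner_smul_right, inner_frame, if_true] at hc ⊢
    linear_combination this - ε * hc
  · simp [inner_sub_right, inner_add_right, real_inner_smul_right]
    ring
  · simp [inner_sub_right, inner_add_right, real_inner_smul_right]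
    ring

/-- At every `p ∈ e` the section has polar angles in `[A, -B]`, which bounds the supremum. It is
attained at the midpoint, where the points realising the two rays can be shrunk into the section; at
an endpoint this could fail. -/
theorem IsLowerRay.dihedralAngle_eq (hconv : Convex ℝ P) {w : ℝ} (hw : 0 < w)
    (hes : e = segment ℝ a (a + w • b 0)) (he : e = faceIn (b 1) P)
    (hA : IsLowerRay P e (b 1) (b 2) a A) (hB : IsLowerRay P e (b 1) (-b 2) a B) :
    dihedralAngle P e = -B - A := by
  have haE : a ∈ e := hes ▸ left_mem_segment ℝ _ _
  have hcE : a + w • b 0 ∈ e := hes ▸ right_mem_segment ℝ _ _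
  have hline : ∀ q ∈ e, ∃ t : ℝ, q = a + t • b 0 := by
    intro q hq
    rw [hes, segment_eq_image'] at hq
    obtain ⟨t, -, rfl⟩ := hq
    exact ⟨t * w, by simp [smul_smul]⟩
  have h2E : ∀ q ∈ e, inner ℝ (b 2) q = inner ℝ (b 2) a := by
    intro q hq
    obtain ⟨t, rfl⟩ := hline q hq
    simp [inner_add_right, real_inner_smul_right]
  have heP : e ⊆ P := he ▸ faceIn_subset _ _
  have hsub : segment ℝ a (a + w • b 0) ⊆ P := hes ▸ heP
  set p₀ := a + (w / 2) • b 0 with hp₀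
  have hp₀E : p₀ ∈ e := by
    rw [hes, segment_eq_image']
    exact ⟨1 / 2, by norm_num, by simp [hp₀, smul_smul]; ring_nf⟩
  have hA1 := hA.neg_lt
  have hA2 := hA.lt
  have hB1 := hB.neg_lt
  have hB2 := hB.lt
  have hneg : ∀ v ∈ P, v ∉ e → inner ℝ (b 1) (v - a) < 0 := by
    subst he
    exact fun v => inner_sub_neg_of_notMem haE
  have hperp : ∀ x : E3, inner ℝ (b 0) (x - p₀) = 0 → ∀ q ∈ e, inner ℝ (x - p₀) (q - p₀) = 0 := by
    intro x hx q hq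
    obtain ⟨t, rfl⟩ := hline q hq
    have : a + t • b 0 - p₀ = (t - w / 2) • b 0 := by rw [hp₀]; module
    rw [this, real_inner_smul_right, real_inner_comm, hx, mul_zero]
  obtain ⟨v, hv, hve, hveq⟩ := hA.attained
  obtain ⟨v', hv', hve', hveq'⟩ := hB.attained
  obtain ⟨ε, hε, x, hx, hx0, hx1, hx2⟩ := exists_mem_orthogonal_section (b := b) hconv hw hsub hv
  obtain ⟨ε', hε', y, hy, hy0, hy1, hy2⟩ :=
    exists_mem_orthogonal_section (b := b) hconv hw hsub hv'
  rw [← hp₀] at hx0 hx1 hx2 hy0 hy1 hy2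
  have hcA : 0 < Real.cos A := Real.cos_pos_of_mem_Ioo ⟨hA1, hA2⟩
  have hcB : 0 < Real.cos B := Real.cos_pos_of_mem_Ioo ⟨hB1, hB2⟩
  have hv1 := hneg v hv hve
  have hv1' := hneg v' hv' hve'
  have hAB : A ≤ -B := by
    obtain ⟨ρ, C, -, h1, h2, -⟩ := hA.exists_polar hB he haE haE rfl hv hve
    exact h1.trans h2
  have hpi : |A - -B| ≤ Real.pi := by rw [abs_le]; constructor <;> linarith
  have habs : |A - -B| = -B - A := by rw [abs_of_nonpos (by linarith)]; ring
  refine IsGreatest.csSup_eq ⟨⟨p₀, hp₀E, x, hx, y, hy, ?_, ?_, hperp x hx0, hperp y hy0, ?_⟩, ?_⟩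
  · rintro rfl
    rw [sub_self, inner_zero_right] at hx1
    nlinarith
  · rintro rfl
    rw [sub_self, inner_zero_right] at hy1
    nlinarith
  · rw [← habs]
    symm
    refine angle_eq_abs_sub b
      (ρ := ε * (-inner ℝ (b 1) (v - a) / Real.cos A))
      (σ := ε' * (-inner ℝ (b 1) (v' - a) / Real.cos B))
      (mul_pos hε (div_pos (by linarith) hcA)) (mul_pos hε' (div_pos (by linarith) hcB))
      hx0 ?_ ?_ hy0 ?_ ?_ hpi
    · rw [vsub_eq_sub, hx1]; field_simp
    · rw [vsub_eq_sub, hx2]; field_simp; linarith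
    · rw [vsub_eq_sub, hy1, Real.cos_neg]; field_simp
    · rw [inner_neg_left] at hveq'
      rw [vsub_eq_sub, hy2, Real.sin_neg]; field_simp; linarith
  · rintro θ ⟨p, hp, x, hx, y, hy, hxp, hyp, hxo, hyo, rfl⟩
    have horth : ∀ z : E3, (∀ q ∈ e, inner ℝ (z - p) (q - p) = 0) →
        inner ℝ (b 0) (z - p) = 0 := by
      intro z hz
      have h1 := hz _ haE
      have h2 := hz _ hcE
      have h3 : inner ℝ (z - p) (w • b 0) = 0 := by
        have : w • b 0 = (a + w • b 0 - p) - (a - p) := by abel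
        rw [this, inner_sub_right, h1, h2, sub_zero]
      rw [real_inner_smul_right, real_inner_comm] at h3
      exact (mul_eq_zero.1 h3).resolve_left hw.ne'
    have hnot : ∀ z : E3, z ≠ p → (∀ q ∈ e, inner ℝ (z - p) (q - p) = 0) → z ∉ e :=
      fun z hzp hz hze => hzp (sub_eq_zero.1 (inner_self_eq_zero.1 (hz z hze)))
    obtain ⟨ρ, C, hρ, c1, c2, c3, c4⟩ :=
      hA.exists_polar hB he haE hp (h2E p hp) hx (hnot x hxp hxo)
    obtain ⟨σ, C', hσ, d1, d2, d3, d4⟩ :=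
      hA.exists_polar hB he haE hp (h2E p hp) hy (hnot y hyp hyo)
    have hCC : |C - C'| ≤ -B - A := by rw [abs_le]; constructor <;> linarith
    rw [EuclideanGeometry.angle, vsub_eq_sub, vsub_eq_sub,
      angle_eq_abs_sub b hρ hσ (horth x hxo) c3 c4 (horth y hyo) d3 d4 (by linarith)]
    exact hCC

end Dihedral

/-! ### Flags at an edge. -/

/-- The two flags of a polytope at an edge, as angles in the plane orthogonal to the edge, and the
dihedral angle as their difference. -/
theorem exists_flag_angles {P e : Set E3} (hP : IsConvexPolytope P)
    (b : OrthonormalBasis (Fin 3) ℝ E3) (he : e ∈ polytopeEdges P) (hne : e ≠ P)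
    (hdir : ∀ x ∈ e, ∀ y ∈ e, ∃ c : ℝ, y - x = c • b 0) :
    ∃ θ₁ θ₂ : Real.Angle,
      (∀ θ, (faceIn (planeDir b (θ + (Real.pi / 2 : ℝ))) (faceIn (planeDir b θ) P) = e ∧
        faceIn (planeDir b θ) P ≠ e) ↔ θ = θ₁) ∧
      (∀ θ, (faceIn (planeDir b (θ - (Real.pi / 2 : ℝ))) (faceIn (planeDir b θ) P) = e ∧
        faceIn (planeDir b θ) P ≠ e) ↔ θ = θ₂) ∧
      θ₁ - θ₂ = ((dihedralAngle P e - Real.pi : ℝ) : Real.Angle) := by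
  obtain ⟨a, w, hw, hes⟩ : ∃ a, ∃ w : ℝ, 0 < w ∧ e = segment ℝ a (a + w • b 0) := by
    obtain ⟨-, a, c, hac, rfl⟩ := he
    obtain ⟨w, hw⟩ := hdir a (left_mem_segment ℝ _ _) c (right_mem_segment ℝ _ _)
    rcases lt_trichotomy w 0 with h | h | h
    · refine ⟨c, -w, by linarith, ?_⟩
      rw [neg_smul, ← hw, segment_symm]
      congr 1
      abel
    · rw [h, zero_smul, sub_eq_zero] at hw
      exact absurd hw.symm hac
    · exact ⟨a, w, h, by rw [← hw, add_sub_cancel]⟩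
  obtain ⟨l, hl⟩ := exists_eq_faceIn_of_mem_polytopeEdges he
  have haE : a ∈ e := hes ▸ left_mem_segment ℝ _ _
  have hcE : a + w • b 0 ∈ e := hes ▸ right_mem_segment ℝ _ _
  have hl0 : l ≠ 0 := by
    rintro rfl
    exact hne (hl.trans (by simp [faceIn]))
  have hlb : inner ℝ (b 0) l = 0 := by
    have h := inner_eq_of_mem_faceIn (hl ▸ hcE) (hl ▸ haE)
    rw [inner_add_right, real_inner_smul_right, add_eq_left, real_inner_comm] at h
    exact (mul_eq_zero.1 h).resolve_left hw.ne'
  obtain ⟨θ₀, c, hc, hlc⟩ := exists_planeDir_smul b hl0 hlb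
  obtain ⟨b', hb0, hb'⟩ := exists_frame_rotate b θ₀
  have hb1 : b' 1 = planeDir b θ₀ := by
    rw [← add_zero θ₀, ← hb']; simp [planeDir]
  -- In the rotated frame the functional exposing `e` is `b' 1`, as the ray lemmas require.
  have heb : e = faceIn (b' 1) P := by rw [hl, hlc, faceIn_smul_left hc, hb1]
  rw [← hb0] at hes
  have hm : ∀ v ∈ e, inner ℝ (b' 2) (v - a) = 0 := by
    intro v hv
    obtain ⟨t, ht⟩ := hdir a haE v hv
    rw [ht, ← hb0]
    simp [real_inner_smul_right]
  have hm' : ∀ v ∈ e, inner ℝ (-b' 2) (v - a) = 0 := fun v hv => by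
    rw [inner_neg_left, hm v hv, neg_zero]
  obtain ⟨A, hA⟩ := exists_isLowerRay hP (heb ▸ haE) (heb ▸ hm) (heb ▸ hne)
  obtain ⟨B, hB⟩ := exists_isLowerRay hP (heb ▸ haE) (heb ▸ hm') (heb ▸ hne)
  rw [← heb] at hA hB
  refine ⟨θ₀ + ((-(Real.pi / 2) - A : ℝ) : Real.Angle),
    θ₀ - ((-(Real.pi / 2) - B : ℝ) : Real.Angle), fun θ => ?_, fun θ => ?_, ?_⟩
  · have h := hA.faceIn_faceIn_eq_iff heb haE hm (θ - θ₀)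
    rw [← planeDir_add_pi_div_two, ← planeDir, hb', hb', ← add_assoc, add_sub_cancel] at h
    rw [h, sub_eq_iff_eq_add']
  -- Replacing `b' 2` by `-b' 2` reverses the sense of rotation, so angles relative to `θ₀` change
  -- sign.
  · have h := hB.faceIn_faceIn_eq_iff heb haE hm' (-(θ - θ₀))
    have e1 : (-Real.Angle.sin (-(θ - θ₀))) • b' 1 + Real.Angle.cos (-(θ - θ₀)) • -b' 2
        = planeDir b (θ - (Real.pi / 2 : ℝ)) := by
      rw [Real.Angle.sin_neg, Real.Angle.cos_neg, neg_neg, smul_neg, ← neg_smul,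
        ← planeDir_sub_pi_div_two, hb']
      congr 1
      abel
    have e2 : Real.Angle.cos (-(θ - θ₀)) • b' 1 + Real.Angle.sin (-(θ - θ₀)) • -b' 2
        = planeDir b θ := by
      rw [Real.Angle.sin_neg, Real.Angle.cos_neg, smul_neg, ← neg_smul, neg_neg, ← planeDir, hb',
        add_sub_cancel]
    rw [e1, e2] at h
    rw [h, neg_eq_iff_eq_neg, sub_eq_iff_eq_add', ← sub_eq_add_neg]
  -- `(-π/2 - A) + (-π/2 - B) = (-B - A) - π`.
  · rw [hA.dihedralAngle_eq hP.convex hw hes heb hB, add_sub_sub_cancel, ← Real.Angle.coe_add]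
    congr 1
    ring

/-- The face selected by a flag of directions orthogonal to `b 0` is a segment along `b 0`. -/
theorem faceIn_faceIn_eq_segment {P : Set E3} (hP : IsConvexPolytope P)
    (b : OrthonormalBasis (Fin 3) ℝ E3) (θ : Real.Angle) {k : E3}
    (hk : k = planeDir b (θ + (Real.pi / 2 : ℝ)) ∨ k = planeDir b (θ - (Real.pi / 2 : ℝ))) :
    ∃ a, ∃ w : ℝ, 0 ≤ w ∧ faceIn k (faceIn (planeDir b θ) P) = segment ℝ a (a + w • b 0) ∧
      flagWidth (b 0) (planeDir b θ) k P = w := by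
  obtain ⟨b', hb0, hb'⟩ := exists_frame_rotate b θ
  have hb1 : b' 1 = planeDir b θ := by
    rw [← add_zero θ, ← hb']; simp [planeDir]
  have hb2 : b' 2 = planeDir b (θ + (Real.pi / 2 : ℝ)) := by
    rw [← hb']; simp [planeDir]
  have hF := faceIn_isCompact (planeDir b θ) hP.isCompact
  have hFn := faceIn_nonempty (planeDir b θ) hP.isCompact hP.nonempty
  rw [flagWidth, ← hb0]
  refine eq_segment_of_subset_line b' (faceIn_isCompact k hF) (faceIn_nonempty k hF hFn)
    (faceIn_convex k (faceIn_convex _ hP.convex)) (fun x hx y hy => ?_) fun x hx y hy => ?_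
  · rw [hb1]
    exact inner_eq_of_mem_faceIn hx.1 hy.1
  · have h := inner_eq_of_mem_faceIn hx hy
    rw [planeDir_sub_eq_neg] at hk
    rcases hk with rfl | rfl
    · rwa [hb2]
    · rw [inner_neg_left, inner_neg_left, neg_inj] at h
      rwa [hb2]

/-! ### Edge directions and the bijection between flags and edges. -/

/-- A frame for each direction, whose first vector points in that direction. -/
theorem exists_frames : ∃ F : Projectivization ℝ E3 → OrthonormalBasis (Fin 3) ℝ E3,
    ∀ L, ∃ c : ℝ, L.rep = c • F L 0 := by
  have h : ∀ L : Projectivization ℝ E3, ∃ b : OrthonormalBasis (Fin 3) ℝ E3, ∃ c : ℝ, L.rep = c • b 0 := by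
    intro L
    have hr : ‖L.rep‖ ≠ 0 := norm_ne_zero_iff.2 L.rep_nonzero
    have ho : Orthonormal ℝ (({0} : Set (Fin 3)).domRestrict
        fun _ => (‖L.rep‖⁻¹ : ℝ) • L.rep) := by
      rw [orthonormal_iff_ite]
      rintro ⟨i, rfl⟩ ⟨j, rfl⟩
      simp only [Set.domRestrict, if_true]
      rw [real_inner_self_eq_norm_sq, norm_smul, norm_inv, norm_norm, inv_mul_cancel₀ hr, one_pow]
    obtain ⟨b, hb⟩ := Orthonormal.exists_orthonormalBasis_extension_of_card_eq (by simp) ho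
    exact ⟨b, ‖L.rep‖, by rw [hb 0 rfl, smul_smul, mul_inv_cancel₀ hr, one_smul]⟩
  choose F c hF using h
  exact ⟨F, fun L => ⟨c L, hF L⟩⟩

/-- All differences of points of `e` are multiples of `u`. -/
def IsParallelTo (e : Set E3) (u : E3) : Prop :=
  ∀ x ∈ e, ∀ y ∈ e, ∃ c : ℝ, y - x = c • u

theorem isParallelTo_segment {a c u : E3} {t : ℝ} (h : c - a = t • u) :
    IsParallelTo (segment ℝ a c) u := by
  intro x hx y hy
  rw [segment_eq_image'] at hx hy
  obtain ⟨r, -, rfl⟩ := hx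
  obtain ⟨s, -, rfl⟩ := hy
  exact ⟨(s - r) * t, by rw [h]; module⟩

section Directions

variable {F : Projectivization ℝ E3 → OrthonormalBasis (Fin 3) ℝ E3}

theorem exists_unique_direction (hF : ∀ L, ∃ c : ℝ, L.rep = c • F L 0) {P e : Set E3}
    (he : e ∈ polytopeEdges P) :
    ∃ L, IsParallelTo e (F L 0) ∧ ∀ L', IsParallelTo e (F L' 0) → L' = L := by
  obtain ⟨-, a, c, hac, rfl⟩ := he
  have hca : c - a ≠ 0 := sub_ne_zero.2 hac.symm
  have huniq : ∀ L', IsParallelTo (segment ℝ a c) (F L' 0) →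
      L' = Projectivization.mk ℝ (c - a) hca := by
    intro L' h
    obtain ⟨s, hs⟩ := h a (left_mem_segment ℝ _ _) c (right_mem_segment ℝ _ _)
    obtain ⟨t, ht⟩ := hF L'
    have hs0 : s ≠ 0 := by
      rintro rfl
      exact hca (by rw [hs, zero_smul])
    rw [← L'.mk_rep, Projectivization.mk_eq_mk_iff']
    exact ⟨t * s⁻¹, by rw [hs, ht, smul_smul, inv_mul_cancel_right₀ hs0]⟩
  refine ⟨_, ?_, huniq⟩
  obtain ⟨t, ht⟩ := hF (Projectivization.mk ℝ (c - a) hca)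
  obtain ⟨r, hr⟩ := Projectivization.exists_smul_eq_mk_rep ℝ (c - a) hca
  refine isParallelTo_segment (t := (r : ℝ)⁻¹ * t) ?_
  rw [← smul_smul, ← ht, ← hr, Units.smul_def, smul_smul, inv_mul_cancel₀ r.ne_zero, one_smul]

variable (F) in
/-- The face selected by the direction at angle `q.2` in the plane orthogonal to `q.1`, and then by
that direction turned by `τ`. -/
noncomputable def flagFace (τ : Real.Angle) (P : Set E3) (q : Projectivization ℝ E3 × Real.Angle) : Set E3 :=
  faceIn (planeDir (F q.1) (q.2 + τ)) (faceIn (planeDir (F q.1) q.2) P)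

variable (F) in
/-- The flags of `P` consisting of an edge and a larger face. -/
def edgeFlags (τ : Real.Angle) (P : Set E3) : Set (Projectivization ℝ E3 × Real.Angle) :=
  {q | Metric.diam (flagFace F τ P q) ≠ 0 ∧
    flagFace F τ P q ≠ faceIn (planeDir (F q.1) q.2) P}

/-- The turn `τ` is a right angle. -/
def IsQuarterTurn (τ : Real.Angle) : Prop :=
  τ = (Real.pi / 2 : ℝ) ∨ τ = -((Real.pi / 2 : ℝ) : Real.Angle)

theorem flagFace_eq_segment {P : Set E3} (hP : IsConvexPolytope P) {τ : Real.Angle}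
    (hτ : IsQuarterTurn τ) (q : Projectivization ℝ E3 × Real.Angle) :
    ∃ a, ∃ w : ℝ, 0 ≤ w ∧ flagFace F τ P q = segment ℝ a (a + w • F q.1 0) ∧
      flagWidth (F q.1 0) (planeDir (F q.1) q.2) (planeDir (F q.1) (q.2 + τ)) P = w := by
  refine faceIn_faceIn_eq_segment hP _ _ (hτ.imp ?_ ?_)
  · rintro rfl
    rfl
  · rintro rfl
    rw [← sub_eq_add_neg]

theorem flagWidth_eq_diam {P : Set E3} (hP : IsConvexPolytope P) {τ : Real.Angle}
    (hτ : IsQuarterTurn τ) (q : Projectivization ℝ E3 × Real.Angle) :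
    flagWidth (F q.1 0) (planeDir (F q.1) q.2) (planeDir (F q.1) (q.2 + τ)) P
      = Metric.diam (flagFace F τ P q) := by
  obtain ⟨a, w, hw, h1, h2⟩ := flagFace_eq_segment (F := F) hP hτ q
  rw [h2, h1, diam_segment, dist_eq_norm, sub_add_cancel_left, norm_neg, norm_smul,
    (F q.1).orthonormal.1 0, mul_one, Real.norm_of_nonneg hw]

/-- The flags of `P` turning in one sense correspond to the edges of `P` other than `P`. -/
theorem bijOn_flagFace {P : Set E3} (hP : IsConvexPolytope P) {τ : Real.Angle}
    (hτ : IsQuarterTurn τ) {dir : Set E3 → Projectivization ℝ E3} {Θ : Set E3 → Real.Angle}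
    (hdir : ∀ e ∈ polytopeEdges P, ∀ L, IsParallelTo e (F L 0) → L = dir e)
    (hΘ : ∀ e ∈ polytopeEdges P, e ≠ P → ∀ θ, (flagFace F τ P (dir e, θ) = e ∧
      faceIn (planeDir (F (dir e)) θ) P ≠ e) ↔ θ = Θ e) :
    Set.BijOn (flagFace F τ P) (edgeFlags F τ P) {e | e ∈ polytopeEdges P ∧ e ≠ P} ∧
      ∀ q ∈ edgeFlags F τ P, q.2 = Θ (flagFace F τ P q) := by
  have hmaps : ∀ q ∈ edgeFlags F τ P,
      flagFace F τ P q ∈ polytopeEdges P ∧ flagFace F τ P q ≠ P := by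
    rintro q ⟨h1, h2⟩
    obtain ⟨a, w, hw, hs, -⟩ := flagFace_eq_segment (F := F) hP hτ q
    refine ⟨⟨?_, a, a + w • F q.1 0, ?_, hs⟩, fun h => h2 ?_⟩
    · obtain ⟨l, hl⟩ := exists_faceIn_eq_faceIn_faceIn hP (planeDir (F q.1) q.2)
        (planeDir (F q.1) (q.2 + τ))
      rw [flagFace, ← hl]
      exact faceIn_isExposed l P
    · intro h
      rw [hs, ← h, segment_same, Metric.diam_singleton] at h1
      exact h1 rfl
    · exact (faceIn_subset _ _).antisymm ((faceIn_subset _ _).trans h.ge)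
  -- The edge determines its flag: its direction gives `q.1`, and the uniqueness in `hΘ` gives
  -- `q.2`.
  have hinv : ∀ q ∈ edgeFlags F τ P,
      q.1 = dir (flagFace F τ P q) ∧ q.2 = Θ (flagFace F τ P q) := by
    intro q hq
    obtain ⟨hE, hne⟩ := hmaps q hq
    obtain ⟨a, w, -, hs, -⟩ := flagFace_eq_segment (F := F) hP hτ q
    have h1 : q.1 = dir (flagFace F τ P q) := by
      apply hdir _ hE
      rw [hs]
      exact isParallelTo_segment (add_sub_cancel_left _ _)
    refine ⟨h1, (hΘ _ hE hne q.2).1 ?_⟩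
    rw [← h1]
    exact ⟨rfl, hq.2.symm⟩
  refine ⟨⟨hmaps, fun q hq q' hq' h => ?_, fun e he => ?_⟩, fun q hq => (hinv q hq).2⟩
  · obtain ⟨h1, h2⟩ := hinv q hq
    obtain ⟨h1', h2'⟩ := hinv q' hq'
    exact Prod.ext (by rw [h1, h1', h]) (by rw [h2, h2', h])
  · obtain ⟨h1, h2⟩ := (hΘ e he.1 he.2 _).2 rfl
    refine ⟨(dir e, Θ e), ⟨?_, ?_⟩, h1⟩
    · rw [h1]
      obtain ⟨⟨-, a, c, hac, rfl⟩, -⟩ := he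
      rwa [diam_segment, dist_ne_zero]
    · rw [h1]
      exact h2.symm

end Directions

/-! ### The Dehn invariant as a sum of width jumps. -/

theorem IsKagan.exists_angle_hom {f : ℝ → ℝ} (hf : IsKagan f) :
    ∃ g : Real.Angle →+ ℝ, ∀ x : ℝ, g x = f x := by
  let φ : ℝ →+ ℝ := AddMonoidHom.mk' f hf.1
  have h : AddSubgroup.zmultiples (2 * Real.pi) ≤ φ.ker := by
    rw [AddSubgroup.zmultiples_le, AddMonoidHom.mem_ker]
    change f (2 * Real.pi) = 0
    rw [two_mul, hf.1, hf.2, add_zero]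
  exact ⟨QuotientAddGroup.lift _ φ h, fun x => rfl⟩

/-- The jump of the width of the faces of `P` along `q.1` at the angle `q.2`. -/
noncomputable def widthJump (F : Projectivization ℝ E3 → OrthonormalBasis (Fin 3) ℝ E3) (P : Set E3)
    (q : Projectivization ℝ E3 × Real.Angle) : ℝ :=
  flagWidth (F q.1 0) (planeDir (F q.1) q.2) (planeDir (F q.1) (q.2 + (Real.pi / 2 : ℝ))) P -
    flagWidth (F q.1 0) (planeDir (F q.1) q.2)
      (planeDir (F q.1) (q.2 + -((Real.pi / 2 : ℝ) : Real.Angle))) P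

theorem widthJump_sum (F : Projectivization ℝ E3 → OrthonormalBasis (Fin 3) ℝ E3) {ι : Type*} (s : Finset ι)
    {P : ι → Set E3} (hP : ∀ i, IsConvexPolytope (P i)) {t : ι → ℝ} (ht : ∀ i, 0 ≤ t i)
    (q : Projectivization ℝ E3 × Real.Angle) :
    widthJump F (∑ i ∈ s, t i • P i) q = ∑ i ∈ s, t i * widthJump F (P i) q := by
  simp only [widthJump, flagWidth_sum _ _ _ s hP ht, mul_sub, Finset.sum_sub_distrib]

theorem faceIn_neg_eq_self {S : Set E3} {k : E3} (h : faceIn k S = S) : faceIn (-k) S = S := by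
  refine (faceIn_subset _ _).antisymm fun x hx => ⟨hx, fun y hy => ?_⟩
  rw [← h] at hx hy
  rw [inner_neg_left, inner_neg_left, inner_eq_of_mem_faceIn hx hy]

/-- If one turn selects the whole face of `planeDir (F q.1) q.2`, the functional is constant there,
so the opposite turn selects it too and the widths cancel. Otherwise a flag can be missing only
because its diameter is zero. -/
theorem widthJump_eq_indicator (F : Projectivization ℝ E3 → OrthonormalBasis (Fin 3) ℝ E3) {P : Set E3}
    (hP : IsConvexPolytope P) (q : Projectivization ℝ E3 × Real.Angle) :
    widthJump F P q =
      (edgeFlags F (Real.pi / 2 : ℝ) P).indicator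
          (fun q => Metric.diam (flagFace F (Real.pi / 2 : ℝ) P q)) q -
        (edgeFlags F (-((Real.pi / 2 : ℝ) : Real.Angle)) P).indicator
          (fun q => Metric.diam (flagFace F (-((Real.pi / 2 : ℝ) : Real.Angle)) P q)) q := by
  have hneg : planeDir (F q.1) (q.2 + -((Real.pi / 2 : ℝ) : Real.Angle))
      = -planeDir (F q.1) (q.2 + (Real.pi / 2 : ℝ)) := by
    rw [← sub_eq_add_neg, planeDir_sub_eq_neg]
  have hiff : flagFace F (Real.pi / 2 : ℝ) P q = faceIn (planeDir (F q.1) q.2) P ↔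
      flagFace F (-((Real.pi / 2 : ℝ) : Real.Angle)) P q = faceIn (planeDir (F q.1) q.2) P := by
    rw [flagFace, flagFace, hneg]
    exact ⟨faceIn_neg_eq_self, fun h => by simpa using faceIn_neg_eq_self h⟩
  rw [widthJump, flagWidth_eq_diam hP (.inl rfl), flagWidth_eq_diam hP (.inr rfl)]
  by_cases h : flagFace F (Real.pi / 2 : ℝ) P q = faceIn (planeDir (F q.1) q.2) P
  · rw [Set.indicator_of_notMem (fun hq => hq.2 h),
      Set.indicator_of_notMem (fun hq => hq.2 (hiff.1 h)), h, hiff.1 h, sub_self, sub_self]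
  · have key : ∀ τ : Real.Angle, flagFace F τ P q ≠ faceIn (planeDir (F q.1) q.2) P →
        (edgeFlags F τ P).indicator (fun q => Metric.diam (flagFace F τ P q)) q
          = Metric.diam (flagFace F τ P q) := by
      intro τ hτ
      by_cases h0 : Metric.diam (flagFace F τ P q) = 0
      · rw [h0, Set.indicator_of_notMem (fun hq => hq.1 h0)]
      · exact Set.indicator_of_mem (show q ∈ edgeFlags F τ P from ⟨h0, hτ⟩) _
    rw [key _ h, key _ (fun h' => h (hiff.2 h'))]

/-- Testing orthogonality against `q = x` gives `x = p`, so no angle is admissible and `sSup ∅ = 0`.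
-/
theorem dihedralAngle_self_of_segment {a c : E3} :
    dihedralAngle (segment ℝ a c) (segment ℝ a c) = 0 := by
  rw [dihedralAngle]
  convert Real.sSup_empty
  rw [Set.eq_empty_iff_forall_notMem]
  rintro θ ⟨p, -, x, hx, -, -, hxp, -, h, -⟩
  exact hxp (sub_eq_zero.1 (inner_self_eq_zero.1 (h x hx)))

/-- The Dehn invariant as a sum of width jumps, which are Minkowski additive. -/
theorem dehnInvariant_eq_finsum {F : Projectivization ℝ E3 → OrthonormalBasis (Fin 3) ℝ E3}
    (hF : ∀ L, ∃ c : ℝ, L.rep = c • F L 0) {f : ℝ → ℝ} (hf : IsKagan f) {g : Real.Angle →+ ℝ}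
    (hg : ∀ x : ℝ, g x = f x) {P : Set E3} (hP : IsConvexPolytope P) :
    (Function.HasFiniteSupport fun q : Projectivization ℝ E3 × Real.Angle => g q.2 * widthJump F P q) ∧
      dehnInvariant f P = ∑ᶠ q : Projectivization ℝ E3 × Real.Angle, g q.2 * widthJump F P q := by
  have hdir : ∀ e, ∃ L, e ∈ polytopeEdges P →
      IsParallelTo e (F L 0) ∧ ∀ L', IsParallelTo e (F L' 0) → L' = L := by
    intro e
    by_cases he : e ∈ polytopeEdges P
    · obtain ⟨L, hL⟩ := exists_unique_direction hF he
      exact ⟨L, fun _ => hL⟩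
    -- An arbitrary direction for sets that are not edges makes `dir` total.
    · obtain ⟨v, hv⟩ := exists_ne (0 : E3)
      exact ⟨Projectivization.mk ℝ v hv, fun h => absurd h he⟩
  choose dir hdir using hdir
  have hΘ : ∀ e ∈ polytopeEdges P, e ≠ P → _ := fun e he hne =>
    exists_flag_angles hP (F (dir e)) he hne (hdir e he).1
  choose! Θ₁ Θ₂ hΘ₁ hΘ₂ hΘ using hΘ
  obtain ⟨hb₁, hi₁⟩ := bijOn_flagFace hP (.inl rfl) (fun e he => (hdir e he).2) hΘ₁
  obtain ⟨hb₂, hi₂⟩ := bijOn_flagFace hP (τ := -((Real.pi / 2 : ℝ) : Real.Angle)) (.inr rfl)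
    (fun e he => (hdir e he).2) (fun e he hne θ => by
      rw [← hΘ₂ e he hne θ, flagFace, ← sub_eq_add_neg])
  have hfin : {e | e ∈ polytopeEdges P ∧ e ≠ P}.Finite :=
    (polytopeEdges_finite hP).subset fun e he => he.1
  have hfin₁ := hb₁.finite_iff_finite.2 hfin
  have hfin₂ := hb₂.finite_iff_finite.2 hfin
  have hsum : ∀ {τ : Real.Angle} {Θ : Set E3 → Real.Angle},
      Set.BijOn (flagFace F τ P) (edgeFlags F τ P) {e | e ∈ polytopeEdges P ∧ e ≠ P} →
      (∀ q ∈ edgeFlags F τ P, q.2 = Θ (flagFace F τ P q)) →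
      ∑ᶠ q, (edgeFlags F τ P).indicator
          (fun q => g q.2 * Metric.diam (flagFace F τ P q)) q
        = ∑ᶠ e ∈ {e | e ∈ polytopeEdges P ∧ e ≠ P}, g (Θ e) * Metric.diam e := by
    intro τ Θ hb hi
    rw [← finsum_mem_def]
    exact finsum_mem_eq_of_bijOn _ hb fun q hq => by rw [hi q hq]
  have hjump : ∀ q : Projectivization ℝ E3 × Real.Angle, g q.2 * widthJump F P q =
      (edgeFlags F (Real.pi / 2 : ℝ) P).indicator
          (fun q => g q.2 * Metric.diam (flagFace F (Real.pi / 2 : ℝ) P q)) q -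
        (edgeFlags F (-((Real.pi / 2 : ℝ) : Real.Angle)) P).indicator
          (fun q => g q.2 * Metric.diam (flagFace F (-((Real.pi / 2 : ℝ) : Real.Angle)) P q)) q := by
    intro q
    rw [widthJump_eq_indicator F hP, mul_sub]
    congr 1 <;>
      exact (Set.indicator_mul_right _ (fun q : Projectivization ℝ E3 × Real.Angle => g q.2) _).symm
  simp only [hjump]
  have hs₁ := hfin₁.subset (Set.support_indicator_subset
    (f := fun q => g q.2 * Metric.diam (flagFace F (Real.pi / 2 : ℝ) P q)))
  have hs₂ := hfin₂.subset (Set.support_indicator_subset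
    (f := fun q => g q.2 * Metric.diam (flagFace F (-((Real.pi / 2 : ℝ) : Real.Angle)) P q)))
  refine ⟨(hs₁.union hs₂).subset (Function.support_sub _ _), ?_⟩
  rw [finsum_sub_distrib hs₁ hs₂, hsum hb₁ hi₁, hsum hb₂ hi₂,
    ← finsum_mem_sub_distrib (fun e => g (Θ₁ e) * Metric.diam e)
      (fun e => g (Θ₂ e) * Metric.diam e) hfin, dehnInvariant]
  have hf0 : f 0 = 0 := by rw [← hg]; simp
  -- If `P` is a segment it is an edge of itself, lost in the flag count; its term is a multiple of
  -- `f 0 = 0`.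
  have hsub : ∑ᶠ e ∈ polytopeEdges P, Metric.diam e * f (dihedralAngle P e)
      = ∑ᶠ e ∈ {e | e ∈ polytopeEdges P ∧ e ≠ P}, Metric.diam e * f (dihedralAngle P e) := by
    refine finsum_mem_inter_support_eq' _ _ _ fun e he => ⟨fun h => ⟨h, ?_⟩, fun h => h.1⟩
    rintro rfl
    obtain ⟨-, a, c, -, rfl⟩ := h
    rw [Function.mem_support, dihedralAngle_self_of_segment, hf0, mul_zero] at he
    exact he rfl
  rw [hsub]
  refine finsum_mem_congr rfl fun e he => ?_
  -- `g (θ₁ - θ₂) = f α - f π = f α`.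
  rw [← sub_mul, ← map_sub, hΘ e he.1 he.2, Real.Angle.coe_sub, map_sub, hg, hg, hf.2, sub_zero,
    mul_comm]

theorem lemma3p2 (k : ℕ) (P : Fin k → Set E3) (hP : ∀ i, IsConvexPolytope (P i))
    (t : Fin k → ℝ) (ht : ∀ i, 0 ≤ t i) (f : ℝ → ℝ) (hf : IsKagan f) :
    dehnInvariant f (∑ i, t i • P i) = ∑ i, t i * dehnInvariant f (P i) := by
  obtain ⟨F, hF⟩ := exists_frames
  obtain ⟨g, hg⟩ := hf.exists_angle_hom
  have h := fun i => dehnInvariant_eq_finsum hF hf hg (hP i)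
  rw [(dehnInvariant_eq_finsum hF hf hg (isConvexPolytope_sum Finset.univ hP t)).2]
  simp only [widthJump_sum F Finset.univ hP ht, Finset.mul_sum]
  -- The exchange of sums is legitimate because each summand has finite support.
  rw [finsum_sum_comm]
  · refine Finset.sum_congr rfl fun i _ => ?_
    rw [(h i).2, mul_finsum]
    exact finsum_congr fun q => by ring
  · intro i _
    refine (h i).1.subset fun q hq => ?_
    rw [Function.mem_support] at hq ⊢
    exact fun h0 => hq (by rw [mul_left_comm, h0, mul_zero])
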